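/- Let $\Omega\subset\mathbb R^d$ be a bounded open set. Let $\tilde L u=-\operatorname{div}(\tilde A\nabla u)+\tilde c\,u$ be a linear elliptic operator on $\Omega$ with Dirichlet boundary condition: $\tilde A\in L^\infty(\Omega;\mathbb R^{d\times d})$ is symmetric with $m\|\xi\|^2\le \tilde A(x)\xi\cdot\xi\le M\|\xi\|^2$ for all $x\in\Omega$, $\xi\in\mathbb R^d$ and some constants $0<m\le M$, and $\tilde c\in L^\infty(\Omega)$ satisfies $\tilde c(x)>0$ for all $x\in\Omega$. The equation $\tilde Lu=g$ with $g\in L^2(\Omega)$ is understood weakly: $u\in H^1_0(\Omega)$ and $\int_\Omega(\tilde A\nabla u\cdot\nabla v+\tilde c\,uv)\,dx=\int_\Omega gv\,dx$ for all $v\in H^1_0(\Omega)$. Let $(\tilde\lambda_i,\tilde\varphi_i)_{i\ge1}$ be the (eigenvalue, eigenfunction) pairs of $\tilde L$: $(\tilde\varphi_i)$ is orthonormal in $L^2(\Omega)$, $\tilde L\tilde\varphi_i=\tilde\lambda_i\tilde\varphi_i$, $\tilde\lambda_1\le\tilde\lambda_2\le\cdots$, and $$\tilde\lambda_i=\inf\Big\{\tfrac{1}{\|w\|_{L^2(\Omega)}^2}\int_\Omega(\tilde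 A\nabla w\cdot\nabla w+\tilde c\,w^2)\,dx \;:\; w\in H^1_0(\Omega)\setminus\{0\},\ \langle w,\tilde\varphi_j\rangle_{L^2(\Omega)}=0\ \text{for all } j<i\Big\}.$$ Let $k\ge1$, $\tilde\Phi_k=\operatorname{span}\{\tilde\varphi_1,\dots,\tilde\varphi_k\}$, $\tilde f_{\mathrm{span}}\in\tilde\Phi_k$ and $u_0\in\tilde\Phi_k$, and define for $t=0,1,2,\dots$ $$u_{t+1}=u_t-\frac{2}{\tilde\lambda_1+\tilde\lambda_k}\big(\tilde Lu_t-\tilde f_{\mathrm{span}}\big).$$ Then $\tilde\lambda_1>0$; all iterates are well defined and satisfy $u_t\in\tilde\Phi_k\subset H^1_0(\Omega)$; the equation $\tilde Lu=\tilde f_{\mathrm{span}}$ has a unique solution $\tilde u_{\mathrm{span}}\in H^1_0(\Omega)$; and, with $\rho=\frac{\tilde\lambda_k-\tilde\lambda_1}{\tilde\lambda_k+\tilde\lambda_1}\in[0,1)$, for every $t\ge0$, $$\|u_{t+1}-\tilde u_{\mathrm{span}}\|_{L^2(\Omega)}\le\rho\,\|u_t-\tilde u_{\mathrm{span}}\|_{L^2(\Omega)}\quad\text{and}\quad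 \|u_t-\tilde u_{\mathrm{span}}\|_{L^2(\Omega)}\le\rho^{\,t}\,\|u_0-\tilde u_{\mathrm{span}}\|_{L^2(\Omega)}.$$ -/

import Mathlib

open MeasureTheory Filter TopologicalSpace Set
open scoped Distributions Gradient ENNReal Matrix

noncomputable section

namespace EllipticGD

/-- Euclidean space `ℝ^d`. -/
abbrev Space (d : ℕ) : Type := EuclideanSpace ℝ (Fin d)

/-- The Hilbert space `L²(Ω; F)` with Lebesgue measure. -/
abbrev L2 {d : ℕ} (Ω : Opens (Space d)) (F : Type) [NormedAddCommGroup F] : Type :=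
  Lp F 2 (volume.restrict (Ω : Set (Space d)))

variable {d : ℕ} {Ω : Opens (Space d)}

theorem gradient_continuous (φ : 𝓓(Ω, ℝ)) : Continuous (∇ (φ : Space d → ℝ)) := by
  have h : Continuous (fderiv ℝ (φ : Space d → ℝ)) :=
    φ.contDiff.continuous_fderiv (by simp)
  exact (InnerProductSpace.toDual ℝ (Space d)).symm.continuous.comp h

theorem gradient_hasCompactSupport (φ : 𝓓(Ω, ℝ)) :
    HasCompactSupport (∇ (φ : Space d → ℝ)) := by
  have h : HasCompactSupport (fderiv ℝ (φ : Space d → ℝ)) := φ.hasCompactSupport.fderiv ℝ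
  exact h.comp_left (g := (InnerProductSpace.toDual ℝ (Space d)).symm) (map_zero _)

theorem memLp_testFunction (φ : 𝓓(Ω, ℝ)) :
    MemLp (φ : Space d → ℝ) 2 (volume.restrict (Ω : Set (Space d))) :=
  φ.continuous.memLp_of_hasCompactSupport φ.hasCompactSupport

theorem memLp_gradient (φ : 𝓓(Ω, ℝ)) :
    MemLp (∇ (φ : Space d → ℝ)) 2 (volume.restrict (Ω : Set (Space d))) :=
  (gradient_continuous φ).memLp_of_hasCompactSupport (gradient_hasCompactSupport φ)

/-- A test function `φ ∈ C_c^∞(Ω)` as an element of `L²(Ω)`. -/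
def testL2 (φ : 𝓓(Ω, ℝ)) : L2 Ω ℝ := (memLp_testFunction φ).toLp _

/-- The classical gradient of a test function as an element of `L²(Ω; ℝ^d)`. -/
def testGradL2 (φ : 𝓓(Ω, ℝ)) : L2 Ω (Space d) := (memLp_gradient φ).toLp _

/-- `G ∈ L²(Ω; ℝ^d)` is the weak gradient of `u ∈ L²(Ω)`: for every `φ ∈ C_c^∞(Ω)`,
`∫_Ω u ∇φ dx = - ∫_Ω φ G dx`. -/
def HasWeakGradient (u : L2 Ω ℝ) (G : L2 Ω (Space d)) : Prop :=
  ∀ φ : 𝓓(Ω, ℝ), ∫ x in (Ω : Set (Space d)), u x • ∇ (φ : Space d → ℝ) x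
    = - ∫ x in (Ω : Set (Space d)), φ x • G x

theorem integrable_smul_gradient (u : L2 Ω ℝ) (φ : 𝓓(Ω, ℝ)) :
    Integrable (fun x => u x • ∇ (φ : Space d → ℝ) x)
      (volume.restrict (Ω : Set (Space d))) :=
  memLp_one_iff_integrable.1 ((memLp_gradient φ).smul (Lp.memLp u) (r := 1))

theorem integrable_testFunction_smul {F : Type} [NormedAddCommGroup F] [NormedSpace ℝ F]
    (G : L2 Ω F) (φ : 𝓓(Ω, ℝ)) :
    Integrable (fun x => φ x • G x) (volume.restrict (Ω : Set (Space d))) :=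
  memLp_one_iff_integrable.1 ((Lp.memLp G).smul (memLp_testFunction φ) (r := 1))

theorem HasWeakGradient.add {u v : L2 Ω ℝ} {G H : L2 Ω (Space d)}
    (hu : HasWeakGradient u G) (hv : HasWeakGradient v H) :
    HasWeakGradient (u + v) (G + H) := by
  intro φ
  have h1 : ∫ x in (Ω : Set (Space d)), (u + v : L2 Ω ℝ) x • ∇ (φ : Space d → ℝ) x
      = ∫ x in (Ω : Set (Space d)), (u x • ∇ (φ : Space d → ℝ) x
          + v x • ∇ (φ : Space d → ℝ) x) := by
    apply integral_congr_ae
    filter_upwards [Lp.coeFn_add u v] with x hx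
    rw [hx, Pi.add_apply, add_smul]
  have h2 : ∫ x in (Ω : Set (Space d)), φ x • (G + H : L2 Ω (Space d)) x
      = ∫ x in (Ω : Set (Space d)), (φ x • G x + φ x • H x) := by
    apply integral_congr_ae
    filter_upwards [Lp.coeFn_add G H] with x hx
    rw [hx, Pi.add_apply, smul_add]
  rw [h1, h2, integral_add (integrable_smul_gradient u φ) (integrable_smul_gradient v φ),
    integral_add (integrable_testFunction_smul G φ) (integrable_testFunction_smul H φ),
    hu φ, hv φ, neg_add]

theorem HasWeakGradient.smul {u : L2 Ω ℝ} {G : L2 Ω (Space d)} (a : ℝ)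
    (hu : HasWeakGradient u G) : HasWeakGradient (a • u) (a • G) := by
  intro φ
  have h1 : ∫ x in (Ω : Set (Space d)), (a • u : L2 Ω ℝ) x • ∇ (φ : Space d → ℝ) x
      = ∫ x in (Ω : Set (Space d)), a • (u x • ∇ (φ : Space d → ℝ) x) := by
    apply integral_congr_ae
    filter_upwards [Lp.coeFn_smul a u] with x hx
    rw [hx, Pi.smul_apply, smul_assoc]
  have h2 : ∫ x in (Ω : Set (Space d)), φ x • (a • G : L2 Ω (Space d)) x
      = ∫ x in (Ω : Set (Space d)), a • (φ x • G x) := by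
    apply integral_congr_ae
    filter_upwards [Lp.coeFn_smul a G] with x hx
    rw [hx, Pi.smul_apply, smul_comm]
  rw [h1, h2, integral_smul, integral_smul, hu φ, smul_neg]

/-- An `L²(Ω)` function whose integral against every test function vanishes is zero. -/
theorem eq_zero_of_forall_testFunction {F : Type} [NormedAddCommGroup F] [NormedSpace ℝ F]
    [CompleteSpace F] (G : L2 Ω F)
    (h : ∀ φ : 𝓓(Ω, ℝ), ∫ x in (Ω : Set (Space d)), φ x • G x = 0) : G = 0 := by
  have hloc : LocallyIntegrableOn (fun x => G x) (Ω : Set (Space d)) volume :=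
    locallyIntegrableOn_of_locallyIntegrable_restrict
      ((Lp.memLp G).locallyIntegrable (by norm_num))
  have key := Ω.isOpen.ae_eq_zero_of_integral_contDiff_smul_eq_zero hloc (by
    intro g hg hgc hgs
    have h0 := h ⟨g, hg, hgc, hgs⟩
    rw [← h0, setIntegral_eq_integral_of_forall_compl_eq_zero]
    · rfl
    · intro x hx
      have : g x = 0 := image_eq_zero_of_notMem_tsupport fun hx' => hx (hgs hx')
      change g x • G x = 0
      rw [this, zero_smul])
  apply Lp.ext
  filter_upwards [(ae_restrict_iff' Ω.isOpen.measurableSet).2 key, Lp.coeFn_zero F 2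
    (volume.restrict (Ω : Set (Space d)))] with x hx h0
  rw [hx, h0, Pi.zero_apply]

theorem HasWeakGradient.unique {u : L2 Ω ℝ} {G H : L2 Ω (Space d)}
    (hG : HasWeakGradient u G) (hH : HasWeakGradient u H) : G = H := by
  have h0 : HasWeakGradient (u + (-1 : ℝ) • u) (G + (-1 : ℝ) • H) := hG.add (hH.smul (-1))
  have hu : u + (-1 : ℝ) • u = 0 := by module
  rw [hu] at h0
  have h1 : G + (-1 : ℝ) • H = 0 := by
    apply eq_zero_of_forall_testFunction
    intro φ
    have h2 : ∫ x in (Ω : Set (Space d)), (0 : L2 Ω ℝ) x • ∇ (φ : Space d → ℝ) x = 0 := by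
      apply integral_eq_zero_of_ae
      filter_upwards [Lp.coeFn_zero ℝ 2 (volume.restrict (Ω : Set (Space d)))] with x hx
      rw [hx, Pi.zero_apply, zero_smul, Pi.zero_apply]
    have h3 := h0 φ
    rw [h2] at h3
    exact neg_eq_zero.1 h3.symm
  have h2 : G = (G + (-1 : ℝ) • H) + H := by module
  rw [h2, h1, zero_add]

variable (Ω) in
/-- `H¹(Ω)`: the `L²` functions that have a weak gradient in `L²`. -/
def H1 : Submodule ℝ (L2 Ω ℝ) where
  carrier := {u | ∃ G : L2 Ω (Space d), HasWeakGradient u G}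
  add_mem' := by
    rintro u v ⟨G, hG⟩ ⟨H, hH⟩
    exact ⟨G + H, hG.add hH⟩
  zero_mem' := by
    refine ⟨(0 : ℝ) • 0, ?_⟩
    have h : HasWeakGradient ((0 : ℝ) • (0 : L2 Ω ℝ)) ((0 : ℝ) • (0 : L2 Ω (Space d))) := by
      intro φ
      have h2 : ∫ x in (Ω : Set (Space d)),
          ((0 : ℝ) • (0 : L2 Ω ℝ) : L2 Ω ℝ) x • ∇ (φ : Space d → ℝ) x = 0 := by
        apply integral_eq_zero_of_ae
        filter_upwards [Lp.coeFn_zero ℝ 2 (volume.restrict (Ω : Set (Space d)))] with x hx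
        rw [smul_zero, hx, Pi.zero_apply, zero_smul, Pi.zero_apply]
      have h3 : ∫ x in (Ω : Set (Space d)),
          φ x • ((0 : ℝ) • (0 : L2 Ω (Space d)) : L2 Ω (Space d)) x = 0 := by
        apply integral_eq_zero_of_ae
        filter_upwards [Lp.coeFn_zero (Space d) 2
          (volume.restrict (Ω : Set (Space d)))] with x hx
        rw [smul_zero, hx, Pi.zero_apply, smul_zero]
      rw [h2, h3, neg_zero]
    rw [smul_zero (0 : ℝ) (A := L2 Ω ℝ)] at h
    exact h
  smul_mem' := by
    rintro a u ⟨G, hG⟩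
    exact ⟨a • G, hG.smul a⟩

/-- The weak gradient `∇u ∈ L²(Ω; ℝ^d)` of `u ∈ H¹(Ω)`. -/
def weakGrad : H1 Ω →ₗ[ℝ] L2 Ω (Space d) where
  toFun u := u.2.choose
  map_add' u v := HasWeakGradient.unique (u + v).2.choose_spec
    (u.2.choose_spec.add v.2.choose_spec)
  map_smul' a u := HasWeakGradient.unique (a • u).2.choose_spec (u.2.choose_spec.smul a)

theorem weakGrad_spec (u : H1 Ω) : HasWeakGradient (u : L2 Ω ℝ) (weakGrad u) :=
  u.2.choose_spec

theorem testL2_add (φ ψ : 𝓓(Ω, ℝ)) : testL2 (φ + ψ) = testL2 φ + testL2 ψ := rfl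

theorem testL2_smul (a : ℝ) (φ : 𝓓(Ω, ℝ)) : testL2 (a • φ) = a • testL2 φ := rfl

theorem testGradL2_add (φ ψ : 𝓓(Ω, ℝ)) :
    testGradL2 (φ + ψ) = testGradL2 φ + testGradL2 ψ := by
  rw [testGradL2, testGradL2, testGradL2, ← MemLp.toLp_add]
  congr 1
  funext x
  have h1 : DifferentiableAt ℝ (φ : Space d → ℝ) x :=
    (φ.contDiff.differentiable (by simp)) x
  have h2 : DifferentiableAt ℝ (ψ : Space d → ℝ) x :=
    (ψ.contDiff.differentiable (by simp)) x
  change gradient ((φ : Space d → ℝ) + (ψ : Space d → ℝ)) x = gradient φ x + gradient ψ x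
  rw [gradient, gradient, gradient, fderiv_add h1 h2, map_add]

theorem testGradL2_smul (a : ℝ) (φ : 𝓓(Ω, ℝ)) :
    testGradL2 (a • φ) = a • testGradL2 φ := by
  rw [testGradL2, testGradL2, ← MemLp.toLp_const_smul]
  congr 1
  funext x
  have h1 : DifferentiableAt ℝ (φ : Space d → ℝ) x :=
    (φ.contDiff.differentiable (by simp)) x
  change gradient (a • (φ : Space d → ℝ)) x = a • gradient φ x
  rw [gradient, gradient, fderiv_const_smul h1, map_smulₛₗ]
  rfl

variable (Ω) in
/-- `H¹₀(Ω)`: the closure of `C_c^∞(Ω)` in `H¹(Ω)`, that is, the `u ∈ H¹(Ω)` that are limits, in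
the `H¹` norm, of a sequence of test functions. -/
def H10 : Submodule ℝ (L2 Ω ℝ) where
  carrier := {u | ∃ (h : u ∈ H1 Ω) (φ : ℕ → 𝓓(Ω, ℝ)),
    Tendsto (fun n => ‖testL2 (φ n) - u‖ ^ 2 + ‖testGradL2 (φ n) - weakGrad ⟨u, h⟩‖ ^ 2)
      atTop (nhds 0)}
  add_mem' := by
    rintro u v ⟨hu, φ, hφ⟩ ⟨hv, ψ, hψ⟩
    refine ⟨(H1 Ω).add_mem hu hv, fun n => φ n + ψ n, ?_⟩
    have hG : weakGrad ⟨u + v, (H1 Ω).add_mem hu hv⟩ = weakGrad ⟨u, hu⟩ + weakGrad ⟨v, hv⟩ :=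
      map_add weakGrad ⟨u, hu⟩ ⟨v, hv⟩
    have hs := (hφ.add hψ).const_mul 2
    rw [add_zero, mul_zero] at hs
    refine squeeze_zero (fun n => by positivity) (fun n => ?_) hs
    rw [hG, testL2_add, testGradL2_add, add_sub_add_comm, add_sub_add_comm]
    nlinarith [norm_add_le (testL2 (φ n) - u) (testL2 (ψ n) - v),
      norm_add_le (testGradL2 (φ n) - weakGrad ⟨u, hu⟩) (testGradL2 (ψ n) - weakGrad ⟨v, hv⟩),
      sq_nonneg (‖testL2 (φ n) - u‖ - ‖testL2 (ψ n) - v‖),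
      sq_nonneg (‖testGradL2 (φ n) - weakGrad ⟨u, hu⟩‖
        - ‖testGradL2 (ψ n) - weakGrad ⟨v, hv⟩‖),
      norm_nonneg (testL2 (φ n) - u + (testL2 (ψ n) - v)),
      norm_nonneg (testGradL2 (φ n) - weakGrad ⟨u, hu⟩
        + (testGradL2 (ψ n) - weakGrad ⟨v, hv⟩)),
      norm_nonneg (testL2 (φ n) - u), norm_nonneg (testL2 (ψ n) - v),
      norm_nonneg (testGradL2 (φ n) - weakGrad ⟨u, hu⟩),
      norm_nonneg (testGradL2 (ψ n) - weakGrad ⟨v, hv⟩)]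
  zero_mem' := by
    refine ⟨(H1 Ω).zero_mem, fun _ => (0 : ℝ) • (0 : 𝓓(Ω, ℝ)), ?_⟩
    have hG : weakGrad ⟨0, (H1 Ω).zero_mem⟩ = 0 := map_zero weakGrad
    have e1 : testL2 ((0 : ℝ) • (0 : 𝓓(Ω, ℝ))) = 0 := by rw [testL2_smul, zero_smul]
    have e2 : testGradL2 ((0 : ℝ) • (0 : 𝓓(Ω, ℝ))) = 0 := by rw [testGradL2_smul, zero_smul]
    rw [hG]
    simp only [e1, e2, sub_zero, norm_zero]
    simp
  smul_mem' := by
    rintro a u ⟨hu, φ, hφ⟩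
    refine ⟨(H1 Ω).smul_mem a hu, fun n => a • φ n, ?_⟩
    have hG : weakGrad ⟨a • u, (H1 Ω).smul_mem a hu⟩ = a • weakGrad ⟨u, hu⟩ :=
      map_smul weakGrad a ⟨u, hu⟩
    have hs := hφ.const_mul (a ^ 2)
    rw [mul_zero] at hs
    refine hs.congr fun n => ?_
    rw [hG, testL2_smul, testGradL2_smul, ← smul_sub, ← smul_sub, norm_smul, norm_smul,
      mul_pow, mul_pow, Real.norm_eq_abs, sq_abs, mul_add]

theorem H10_le_H1 : H10 Ω ≤ H1 Ω := fun _ h => h.1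

/-- The weak gradient on `H¹₀(Ω)`. -/
def grad0 : H10 Ω →ₗ[ℝ] L2 Ω (Space d) := weakGrad ∘ₗ Submodule.inclusion H10_le_H1

theorem hasWeakGradient_test (φ : 𝓓(Ω, ℝ)) : HasWeakGradient (testL2 φ) (testGradL2 φ) := by
  intro ψ
  have e1 : ∫ x in (Ω : Set (Space d)), testL2 φ x • ∇ (ψ : Space d → ℝ) x
      = ∫ x, φ x • ∇ (ψ : Space d → ℝ) x := by
    rw [← setIntegral_eq_integral_of_forall_compl_eq_zero (s := (Ω : Set (Space d)))
      (f := fun x => φ x • ∇ (ψ : Space d → ℝ) x)]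
    · apply integral_congr_ae
      filter_upwards [(memLp_testFunction φ).coeFn_toLp] with x hx
      rw [testL2, hx]
    · intro x hx
      rw [image_eq_zero_of_notMem_tsupport fun hx' => hx (φ.tsupport_subset hx'), zero_smul]
  have e2 : ∫ x in (Ω : Set (Space d)), ψ x • testGradL2 φ x
      = ∫ x, ψ x • ∇ (φ : Space d → ℝ) x := by
    rw [← setIntegral_eq_integral_of_forall_compl_eq_zero (s := (Ω : Set (Space d)))
      (f := fun x => ψ x • ∇ (φ : Space d → ℝ) x)]
    · apply integral_congr_ae
      filter_upwards [(memLp_gradient φ).coeFn_toLp] with x hx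
      rw [testGradL2, hx]
    · intro x hx
      rw [image_eq_zero_of_notMem_tsupport fun hx' => hx (ψ.tsupport_subset hx'), zero_smul]
  rw [e1, e2]
  have hint : ∀ f g : 𝓓(Ω, ℝ), Integrable (fun x => f x • ∇ (g : Space d → ℝ) x) := fun f g =>
    (f.continuous.smul (gradient_continuous g)).integrable_of_hasCompactSupport
      f.hasCompactSupport.smul_right
  have hd : ∀ f : 𝓓(Ω, ℝ), Differentiable ℝ (f : Space d → ℝ) := fun f =>
    f.contDiff.differentiable (by simp)
  have hin : ∀ (f g : 𝓓(Ω, ℝ)) (v x : Space d),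
      inner ℝ v (f x • ∇ (g : Space d → ℝ) x) = f x * fderiv ℝ (g : Space d → ℝ) x v := by
    intro f g v x
    rw [real_inner_smul_right, real_inner_comm, gradient, InnerProductSpace.toDual_symm_apply]
  refine ext_inner_left ℝ fun v => ?_
  rw [inner_neg_right, ← integral_inner (hint φ ψ), ← integral_inner (hint ψ φ)]
  simp only [hin]
  have hi : ∀ f g : 𝓓(Ω, ℝ), Integrable (fun x => f x * fderiv ℝ (g : Space d → ℝ) x v) := by
    intro f g
    have := (hint f g).const_inner (𝕜 := ℝ) v
    simpa only [hin] using this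
  have hp := integral_mul_fderiv_eq_neg_fderiv_mul_of_integrable (μ := volume) (v := v)
    (f := (φ : Space d → ℝ)) (g := (ψ : Space d → ℝ))
    (by simpa only [mul_comm] using hi ψ φ) (hi φ ψ)
    ((φ.continuous.mul ψ.continuous).integrable_of_hasCompactSupport
      φ.hasCompactSupport.mul_right) (fun x _ => hd φ x) (fun x _ => hd ψ x)
  rw [hp]
  simp only [mul_comm]

theorem testL2_mem_H10 (φ : 𝓓(Ω, ℝ)) : testL2 φ ∈ H10 Ω := by
  have h : testL2 φ ∈ H1 Ω := ⟨_, hasWeakGradient_test φ⟩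
  have hG : weakGrad ⟨testL2 φ, h⟩ = testGradL2 φ :=
    (weakGrad_spec ⟨testL2 φ, h⟩).unique (hasWeakGradient_test φ)
  refine ⟨h, fun _ => φ, ?_⟩
  simp [hG]

/-- An `L²(Ω)` function orthogonal to `H¹₀(Ω)` is zero. -/
theorem eq_zero_of_forall_H10 (g : L2 Ω ℝ)
    (h : ∀ v : H10 Ω, inner ℝ g (v : L2 Ω ℝ) = (0 : ℝ)) : g = 0 := by
  apply eq_zero_of_forall_testFunction
  intro φ
  rw [← h ⟨testL2 φ, testL2_mem_H10 φ⟩, L2.inner_def]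
  apply integral_congr_ae
  filter_upwards [(memLp_testFunction φ).coeFn_toLp] with x hx
  rw [testL2, hx, smul_eq_mul, RCLike.inner_apply, conj_trivial]

variable (Ω) in
/-- The coefficients of a linear elliptic operator `L u = -div(A ∇u) + c u` in divergence form:
`A` is symmetric and uniformly elliptic, `c` is positive, and both are (essentially) bounded and
measurable on `Ω`. -/
structure EllipticCoeff where
  /-- The matrix-valued coefficient. -/
  A : Space d → Matrix (Fin d) (Fin d) ℝ
  /-- The zeroth-order coefficient. -/
  c : Space d → ℝ
  A_bdd : ∀ i j, MemLp (fun x => A x i j) ∞ (volume.restrict (Ω : Set (Space d)))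
  c_bdd : MemLp c ∞ (volume.restrict (Ω : Set (Space d)))
  A_symm : ∀ x ∈ Ω, (A x).IsSymm
  elliptic : ∃ m M : ℝ, 0 < m ∧ m ≤ M ∧ ∀ x ∈ Ω, ∀ ξ : Space d,
    m * ‖ξ‖ ^ 2 ≤ ∑ i, ∑ j, A x i j * ξ i * ξ j ∧
      ∑ i, ∑ j, A x i j * ξ i * ξ j ≤ M * ‖ξ‖ ^ 2
  c_pos : ∀ x ∈ Ω, 0 < c x

namespace EllipticCoeff

variable (P : EllipticCoeff Ω)

/-- The integrand `A ∇u · ∇v + c u v`. -/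
def integrand (u v : H10 Ω) (x : Space d) : ℝ :=
  (∑ i, ∑ j, P.A x i j * grad0 u x j * grad0 v x i)
    + P.c x * (u : L2 Ω ℝ) x * (v : L2 Ω ℝ) x

theorem integrable_mul_mul {a : Space d → ℝ} (f g : Space d → ℝ)
    (ha : MemLp a ∞ (volume.restrict (Ω : Set (Space d))))
    (hf : MemLp f 2 (volume.restrict (Ω : Set (Space d))))
    (hg : MemLp g 2 (volume.restrict (Ω : Set (Space d)))) :
    Integrable (fun x => a x * f x * g x) (volume.restrict (Ω : Set (Space d))) := by
  have h1 : MemLp (a • f) 2 (volume.restrict (Ω : Set (Space d))) := hf.smul ha (r := 2)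
  have h2 : MemLp ((a • f) • g) 1 (volume.restrict (Ω : Set (Space d))) := hg.smul h1 (r := 1)
  exact memLp_one_iff_integrable.1 h2

theorem memLp_coord (G : L2 Ω (Space d)) (i : Fin d) :
    MemLp (fun x => G x i) 2 (volume.restrict (Ω : Set (Space d))) :=
  (EuclideanSpace.proj (𝕜 := ℝ) i).comp_memLp' (Lp.memLp G)

theorem integrable_integrand (u v : H10 Ω) :
    Integrable (P.integrand u v) (volume.restrict (Ω : Set (Space d))) := by
  refine Integrable.add ?_ (integrable_mul_mul _ _ P.c_bdd (Lp.memLp _) (Lp.memLp _))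
  refine integrable_finsetSum _ fun i _ => integrable_finsetSum _ fun j _ => ?_
  exact integrable_mul_mul _ _ (P.A_bdd i j) (memLp_coord _ j) (memLp_coord _ i)

/-- The bilinear form `b(u, v) = ∫_Ω (A ∇u · ∇v + c u v) dx` on `H¹₀(Ω)`. -/
def form : H10 Ω →ₗ[ℝ] H10 Ω →ₗ[ℝ] ℝ :=
  LinearMap.mk₂ ℝ (fun u v => ∫ x in (Ω : Set (Space d)), P.integrand u v x)
    (by
      intro u w v
      rw [← integral_add (P.integrable_integrand u v) (P.integrable_integrand w v)]
      apply integral_congr_ae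
      filter_upwards [Lp.coeFn_add (grad0 u) (grad0 w),
        Lp.coeFn_add (u : L2 Ω ℝ) (w : L2 Ω ℝ)] with x h1 h2
      simp only [integrand, map_add, Submodule.coe_add, h1, h2, Pi.add_apply, PiLp.add_apply,
        mul_add, add_mul, Finset.sum_add_distrib]
      ring)
    (by
      intro a u v
      rw [← integral_smul]
      apply integral_congr_ae
      filter_upwards [Lp.coeFn_smul a (grad0 u), Lp.coeFn_smul a (u : L2 Ω ℝ)] with x h1 h2
      simp only [integrand, map_smul, Submodule.coe_smul, h1, h2, Pi.smul_apply,
        PiLp.smul_apply, smul_eq_mul, mul_add, Finset.mul_sum]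
      congr 1
      · exact Finset.sum_congr rfl fun i _ => Finset.sum_congr rfl fun j _ => by ring
      · ring)
    (by
      intro u v w
      rw [← integral_add (P.integrable_integrand u v) (P.integrable_integrand u w)]
      apply integral_congr_ae
      filter_upwards [Lp.coeFn_add (grad0 v) (grad0 w),
        Lp.coeFn_add (v : L2 Ω ℝ) (w : L2 Ω ℝ)] with x h1 h2
      simp only [integrand, map_add, Submodule.coe_add, h1, h2, Pi.add_apply, PiLp.add_apply,
        mul_add, add_mul, Finset.sum_add_distrib]
      ring)
    (by
      intro a u v
      rw [← integral_smul]
      apply integral_congr_ae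
      filter_upwards [Lp.coeFn_smul a (grad0 v), Lp.coeFn_smul a (v : L2 Ω ℝ)] with x h1 h2
      simp only [integrand, map_smul, Submodule.coe_smul, h1, h2, Pi.smul_apply,
        PiLp.smul_apply, smul_eq_mul, mul_add, Finset.mul_sum]
      congr 1
      · exact Finset.sum_congr rfl fun i _ => Finset.sum_congr rfl fun j _ => by ring
      · ring)

/-- `u ∈ H¹₀(Ω)` and `g ∈ L²(Ω)` satisfy `L u = g` weakly: `b(u, v) = ⟨g, v⟩` for all
`v ∈ H¹₀(Ω)`. -/
def IsWeakSolution (u : L2 Ω ℝ) (g : L2 Ω ℝ) : Prop :=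
  ∃ h : u ∈ H10 Ω, ∀ v : H10 Ω, P.form ⟨u, h⟩ v = inner ℝ g (v : L2 Ω ℝ)

variable {P} in
theorem IsWeakSolution.add {u v g h : L2 Ω ℝ} (hu : P.IsWeakSolution u g)
    (hv : P.IsWeakSolution v h) : P.IsWeakSolution (u + v) (g + h) := by
  obtain ⟨mu, hu⟩ := hu
  obtain ⟨mv, hv⟩ := hv
  refine ⟨(H10 Ω).add_mem mu mv, fun w => ?_⟩
  have e : (⟨u + v, (H10 Ω).add_mem mu mv⟩ : H10 Ω) = ⟨u, mu⟩ + ⟨v, mv⟩ := rfl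
  rw [e, map_add, LinearMap.add_apply, hu, hv, inner_add_left]

variable {P} in
theorem IsWeakSolution.smul {u g : L2 Ω ℝ} (a : ℝ) (hu : P.IsWeakSolution u g) :
    P.IsWeakSolution (a • u) (a • g) := by
  obtain ⟨mu, hu⟩ := hu
  refine ⟨(H10 Ω).smul_mem a mu, fun w => ?_⟩
  have e : (⟨a • u, (H10 Ω).smul_mem a mu⟩ : H10 Ω) = a • ⟨u, mu⟩ := rfl
  rw [e, map_smul, LinearMap.smul_apply, hu, real_inner_smul_left, smul_eq_mul]

variable {P} in
theorem IsWeakSolution.unique {u g h : L2 Ω ℝ} (hg : P.IsWeakSolution u g)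
    (hh : P.IsWeakSolution u h) : g = h := by
  obtain ⟨mu, hg⟩ := hg
  obtain ⟨_, hh⟩ := hh
  rw [← sub_eq_zero]
  apply eq_zero_of_forall_H10
  intro v
  rw [inner_sub_left, ← hg v, ← hh v, sub_self]

/-- The elliptic operator `L u = -div(A ∇u) + c u` with Dirichlet boundary condition, as an
unbounded linear operator in `L²(Ω)`: its domain consists of the `u ∈ H¹₀(Ω)` for which
`-div(A ∇u) + c u`, understood weakly, is a function in `L²(Ω)`. -/
def operator : L2 Ω ℝ →ₗ.[ℝ] L2 Ω ℝ where
  domain :=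
    { carrier := {u | ∃ g, P.IsWeakSolution u g}
      add_mem' := by
        rintro u v ⟨g, hg⟩ ⟨h, hh⟩
        exact ⟨g + h, hg.add hh⟩
      zero_mem' := ⟨0, (H10 Ω).zero_mem, fun v => by
        have e : (⟨0, (H10 Ω).zero_mem⟩ : H10 Ω) = 0 := rfl
        rw [e, map_zero, LinearMap.zero_apply, inner_zero_left]⟩
      smul_mem' := by
        rintro a u ⟨g, hg⟩
        exact ⟨a • g, hg.smul a⟩ }
  toFun :=
    { toFun := fun u => u.2.choose
      map_add' := fun u v => (u + v).2.choose_spec.unique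
        (u.2.choose_spec.add v.2.choose_spec)
      map_smul' := fun a u => (a • u).2.choose_spec.unique (u.2.choose_spec.smul a) }

theorem operator_spec (u : P.operator.domain) : P.IsWeakSolution (u : L2 Ω ℝ) (P.operator u) :=
  u.2.choose_spec

/-- `(lam i, φ i)`, `i = 0, 1, 2, …`, are the eigenpairs of `L`: the `φ i` are `L²`-orthonormal
eigenfunctions, the eigenvalues are listed in nondecreasing order, and the `i`-th one is the
infimum of the Rayleigh quotient `⟨L w, w⟩ / ‖w‖²` over the nonzero `w ∈ H¹₀(Ω)` that are
`L²`-orthogonal to the preceding eigenfunctions. -/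
structure IsEigenSystem (lam : ℕ → ℝ) (φ : ℕ → L2 Ω ℝ) : Prop where
  orthonormal : Orthonormal ℝ φ
  eigen : ∀ i, ∃ h : φ i ∈ P.operator.domain, P.operator ⟨φ i, h⟩ = lam i • φ i
  monotone : Monotone lam
  rayleigh : ∀ i, IsGLB
    {r : ℝ | ∃ w : H10 Ω, w ≠ 0 ∧ (∀ j < i, inner ℝ (φ j) (w : L2 Ω ℝ) = (0 : ℝ)) ∧
      r = P.form w w / ‖(w : L2 Ω ℝ)‖ ^ 2} (lam i)

end EllipticCoeff

/-- `Φ_k`, the span of the first `k` eigenfunctions. -/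
def eigenSpan (φ : ℕ → L2 Ω ℝ) (k : ℕ) : Submodule ℝ (L2 Ω ℝ) :=
  Submodule.span ℝ (φ '' {i | i < k})

end EllipticGD

end

/-!
The operator acts diagonally on the span of the first `k` eigenfunctions: it multiplies the
coefficient along `φ i` by `lam i` (`isWeakSolution_sum`). All coefficients of the equation
`L u = f` with `f` in the span can therefore be divided by `lam i`, which gives a solution in the
span, and one step of the iteration multiplies the coefficient of the error along `φ i` by
`1 - 2 lam i / (lam 0 + lam (k - 1))`. For `lam 0 ≤ lam i ≤ lam (k - 1)` this factor has absolute
value at most `ρ = (lam (k - 1) - lam 0) / (lam (k - 1) + lam 0)`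
(`abs_one_sub_two_div_mul_le`), and by orthonormality the `L²` norm of the error contracts by `ρ`
(`norm_sum_smul_le`).

Positivity of `lam 0` and uniqueness of solutions both come from positive definiteness of the
bilinear form (`form_self_pos`): ellipticity makes the gradient term nonnegative, and `c > 0` makes
`∫ c u²` positive unless `u = 0`. No Poincaré inequality and no compactness is used.
-/

namespace EllipticGD

/-- The energy of a nonzero `u ∈ H¹₀(Ω)` is positive. -/
theorem EllipticCoeff.form_self_pos {d : ℕ} {Ω : Opens (Space d)} (P : EllipticCoeff Ω)
    {u : H10 Ω} (hu : u ≠ 0) : 0 < P.form u u := by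
  obtain ⟨m, M, hm, -, hell⟩ := P.elliptic
  have hmeas : MeasurableSet (Ω : Set (Space d)) := Ω.isOpen.measurableSet
  have hdiff : ∀ x ∈ Ω, P.c x * ((u : L2 Ω ℝ) x) ^ 2 ≤ P.integrand u u x := by
    intro x hx
    have hA : 0 ≤ ∑ i, ∑ j, P.A x i j * grad0 u x j * grad0 u x i := by
      refine le_trans (by positivity) ((hell x hx (grad0 u x)).1.trans (le_of_eq ?_))
      exact Finset.sum_congr rfl fun i _ => Finset.sum_congr rfl fun j _ => by ring
    rw [integrand]
    nlinarith
  have hnonneg : 0 ≤ᵐ[volume.restrict (Ω : Set (Space d))] P.integrand u u :=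
    (ae_restrict_iff' hmeas).2 <| Eventually.of_forall fun x hx =>
      (mul_nonneg (P.c_pos x hx).le (sq_nonneg _)).trans (hdiff x hx)
  refine lt_of_le_of_ne (integral_nonneg_of_ae hnonneg) fun h0 => hu ?_
  have hzero := (integral_eq_zero_iff_of_nonneg_ae hnonneg (P.integrable_integrand u u)).1 h0.symm
  apply Subtype.ext
  apply Lp.ext
  filter_upwards [hzero, ae_restrict_mem hmeas,
    Lp.coeFn_zero ℝ 2 (volume.restrict (Ω : Set (Space d)))] with x hx hxΩ hx0
  have h1 := hdiff x hxΩ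
  rw [hx, Pi.zero_apply] at h1
  have h2 : ((u : L2 Ω ℝ) x) ^ 2 = 0 :=
    le_antisymm (nonpos_of_mul_nonpos_right h1 (P.c_pos x hxΩ)) (sq_nonneg _)
  rw [pow_eq_zero_iff two_ne_zero] at h2
  rw [h2]
  exact hx0.symm

theorem EllipticCoeff.IsWeakSolution.exists_operator_eq {d : ℕ} {Ω : Opens (Space d)}
    {P : EllipticCoeff Ω} {u g : L2 Ω ℝ} (h : P.IsWeakSolution u g) :
    ∃ hu : u ∈ P.operator.domain, P.operator ⟨u, hu⟩ = g :=
  ⟨⟨g, h⟩, (P.operator_spec ⟨u, ⟨g, h⟩⟩).unique h⟩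

theorem EllipticCoeff.operator_injective {d : ℕ} {Ω : Opens (Space d)} (P : EllipticCoeff Ω) :
    Function.Injective P.operator := by
  refine (injective_iff_map_eq_zero P.operator.toFun).2 fun w hw => ?_
  obtain ⟨hm, hform⟩ := P.operator_spec w
  by_contra hne
  have hpos : 0 < P.form ⟨w, hm⟩ ⟨w, hm⟩ :=
    P.form_self_pos fun h => hne (Subtype.ext (congrArg (Subtype.val : H10 Ω → L2 Ω ℝ) h))
  have hw' : P.operator w = 0 := hw
  rw [hform, hw', inner_zero_left] at hpos
  exact lt_irrefl _ hpos

theorem EllipticCoeff.IsEigenSystem.lam_zero_pos {d : ℕ} {Ω : Opens (Space d)}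
    {P : EllipticCoeff Ω} {lam : ℕ → ℝ} {φ : ℕ → L2 Ω ℝ} (hφ : P.IsEigenSystem lam φ) :
    0 < lam 0 := by
  obtain ⟨h, he⟩ := hφ.eigen 0
  obtain ⟨hm, hform⟩ := P.operator_spec ⟨φ 0, h⟩
  have hpos : 0 < P.form ⟨φ 0, hm⟩ ⟨φ 0, hm⟩ :=
    P.form_self_pos fun h0 => hφ.orthonormal.ne_zero 0 (congrArg Subtype.val h0)
  rw [hform, he, real_inner_smul_left, real_inner_self_eq_norm_sq, hφ.orthonormal.1 0] at hpos
  simpa using hpos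

/-- The operator is diagonal on finite combinations of eigenfunctions. -/
theorem EllipticCoeff.IsEigenSystem.isWeakSolution_sum {d : ℕ} {Ω : Opens (Space d)}
    {P : EllipticCoeff Ω} {lam : ℕ → ℝ} {φ : ℕ → L2 Ω ℝ} (hφ : P.IsEigenSystem lam φ)
    (s : Finset ℕ) (a : ℕ → ℝ) :
    P.IsWeakSolution (∑ i ∈ s, a i • φ i) (∑ i ∈ s, (a i * lam i) • φ i) := by
  induction s using Finset.induction_on with
  | empty =>
    simp only [Finset.sum_empty]
    have h := P.operator_spec 0
    rwa [LinearPMap.map_zero] at h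
  | insert i s his ih =>
    rw [Finset.sum_insert his, Finset.sum_insert his, mul_smul]
    obtain ⟨h, he⟩ := hφ.eigen i
    have hi := P.operator_spec ⟨φ i, h⟩
    rw [he] at hi
    exact (hi.smul (a i)).add ih

theorem mem_eigenSpan_iff {d : ℕ} {Ω : Opens (Space d)} {φ : ℕ → L2 Ω ℝ} {k : ℕ}
    {x : L2 Ω ℝ} :
    x ∈ eigenSpan φ k ↔ ∃ a : ℕ → ℝ, ∑ i ∈ Finset.range k, a i • φ i = x := by
  have h : {i | i < k} = (Finset.range k : Set ℕ) := by
    ext i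
    simp
  rw [eigenSpan, h, Submodule.mem_span_image_finset_iff_exists_fun']

/-- Scaling the coefficients of an orthonormal expansion by factors of absolute value at most `r`
scales the norm by at most `r`. -/
theorem norm_sum_smul_le {ι E : Type*} [NormedAddCommGroup E] [InnerProductSpace ℝ E]
    {v : ι → E} (hv : Orthonormal ℝ v) (s : Finset ι) {a b : ι → ℝ} {r : ℝ} (hr : 0 ≤ r)
    (hb : ∀ i ∈ s, |b i| ≤ r) :
    ‖∑ i ∈ s, (b i * a i) • v i‖ ≤ r * ‖∑ i ∈ s, a i • v i‖ := by
  have hsq : ∀ c : ι → ℝ, ‖∑ i ∈ s, c i • v i‖ ^ 2 = ∑ i ∈ s, c i ^ 2 := by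
    intro c
    rw [← real_inner_self_eq_norm_sq, hv.inner_sum]
    simp [sq]
  refine le_of_sq_le_sq ?_ (by positivity)
  rw [mul_pow, hsq, hsq, Finset.mul_sum]
  refine Finset.sum_le_sum fun i hi => ?_
  rw [mul_pow]
  exact mul_le_mul_of_nonneg_right (sq_le_sq' (abs_le.1 (hb i hi)).1 (abs_le.1 (hb i hi)).2)
    (sq_nonneg _)

/-- The step size `2 / (a + b)` equalises the contraction factors at the two ends of the
spectral interval `[a, b]`. -/
theorem abs_one_sub_two_div_mul_le {a b x : ℝ} (ha : 0 < a) (hax : a ≤ x) (hxb : x ≤ b) :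
    |1 - 2 / (a + b) * x| ≤ (b - a) / (b + a) := by
  have hpos : 0 < b + a := by linarith
  have h : 1 - 2 / (a + b) * x = (b + a - 2 * x) / (b + a) := by
    rw [add_comm a b]
    field_simp
  rw [h, abs_div, abs_of_pos hpos]
  gcongr
  exact abs_le.2 ⟨by linarith, by linarith⟩

end EllipticGD

theorem mainTheorem5 {d : ℕ} (Ω : TopologicalSpace.Opens (EllipticGD.Space d))
    (hΩ : Bornology.IsBounded (Ω : Set (EllipticGD.Space d)))
    (P : EllipticGD.EllipticCoeff Ω)
    (lam : ℕ → ℝ) (φ : ℕ → EllipticGD.L2 Ω ℝ) (hφ : P.IsEigenSystem lam φ)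
    (k : ℕ) (hk : 1 ≤ k)
    (fspan : EllipticGD.L2 Ω ℝ) (hf : fspan ∈ EllipticGD.eigenSpan φ k)
    (u : ℕ → EllipticGD.L2 Ω ℝ) (hu0 : u 0 ∈ EllipticGD.eigenSpan φ k)
    (hu : ∀ (t : ℕ) (ht : u t ∈ P.operator.domain),
      u (t + 1) = u t - (2 / (lam 0 + lam (k - 1))) • (P.operator ⟨u t, ht⟩ - fspan)) :
    0 < lam 0 ∧
    0 ≤ (lam (k - 1) - lam 0) / (lam (k - 1) + lam 0) ∧
    (lam (k - 1) - lam 0) / (lam (k - 1) + lam 0) < 1 ∧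
    (∀ t, u t ∈ EllipticGD.eigenSpan φ k ∧ u t ∈ EllipticGD.H10 Ω ∧
      u t ∈ P.operator.domain) ∧
    (∃! uSol : P.operator.domain, P.operator uSol = fspan) ∧
    ∀ uSol : P.operator.domain, P.operator uSol = fspan →
      ∀ t, ‖u (t + 1) - uSol‖
          ≤ (lam (k - 1) - lam 0) / (lam (k - 1) + lam 0) * ‖u t - uSol‖ ∧
        ‖u t - uSol‖
          ≤ ((lam (k - 1) - lam 0) / (lam (k - 1) + lam 0)) ^ t * ‖u 0 - uSol‖ := by
  have hpos := hφ.lam_zero_pos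
  have hmono := hφ.monotone (Nat.zero_le (k - 1))
  have hden : 0 < lam (k - 1) + lam 0 := by linarith
  have hρ0 : 0 ≤ (lam (k - 1) - lam 0) / (lam (k - 1) + lam 0) :=
    div_nonneg (by linarith) hden.le
  have hlam : ∀ i, 0 < lam i := fun i => hpos.trans_le (hφ.monotone (Nat.zero_le i))
  obtain ⟨b, rfl⟩ := EllipticGD.mem_eigenSpan_iff.1 hf
  -- Dividing each coefficient by its eigenvalue solves the equation within the span.
  obtain ⟨hsol, hsolve⟩ :=
    (hφ.isWeakSolution_sum (Finset.range k) fun i => b i / lam i).exists_operator_eq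
  simp only [div_mul_cancel₀ _ (hlam _).ne'] at hsolve
  -- The error is tracked by its coefficients, each of which evolves on its own.
  have step : ∀ t (a : ℕ → ℝ), ∑ i ∈ Finset.range k, a i • φ i = u t →
      ∑ i ∈ Finset.range k,
        (a i - 2 / (lam 0 + lam (k - 1)) * (a i * lam i - b i)) • φ i = u (t + 1) := by
    intro t a ha
    obtain ⟨hd, hop⟩ := (hφ.isWeakSolution_sum (Finset.range k) a).exists_operator_eq
    simp only [ha] at hd hop
    rw [hu t hd, hop, ← ha, ← Finset.sum_sub_distrib, Finset.smul_sum, ← Finset.sum_sub_distrib]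
    exact Finset.sum_congr rfl fun i _ => by module
  have hspan : ∀ t, u t ∈ EllipticGD.eigenSpan φ k := by
    intro t
    induction t with
    | zero => exact hu0
    | succ t ih =>
      obtain ⟨a, ha⟩ := EllipticGD.mem_eigenSpan_iff.1 ih
      exact EllipticGD.mem_eigenSpan_iff.2 ⟨_, step t a ha⟩
  refine ⟨hpos, hρ0, (div_lt_one hden).2 (by linarith), fun t => ?_,
    ⟨⟨_, hsol⟩, hsolve, fun w hw => P.operator_injective (hw.trans hsolve.symm)⟩, fun w hw => ?_⟩
  · obtain ⟨a, ha⟩ := EllipticGD.mem_eigenSpan_iff.1 (hspan t)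
    have hweak := hφ.isWeakSolution_sum (Finset.range k) a
    rw [ha] at hweak
    exact ⟨hspan t, hweak.1, _, hweak⟩
  · obtain rfl := P.operator_injective (hw.trans hsolve.symm)
    have contract : ∀ t,
        ‖u (t + 1) - ∑ i ∈ Finset.range k, (b i / lam i) • φ i‖
          ≤ (lam (k - 1) - lam 0) / (lam (k - 1) + lam 0)
            * ‖u t - ∑ i ∈ Finset.range k, (b i / lam i) • φ i‖ := by
      intro t
      obtain ⟨a, ha⟩ := EllipticGD.mem_eigenSpan_iff.1 (hspan t)
      rw [← step t a ha, ← ha, ← Finset.sum_sub_distrib, ← Finset.sum_sub_distrib]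
      simp only [← sub_smul]
      refine le_trans (le_of_eq ?_) (EllipticGD.norm_sum_smul_le hφ.orthonormal (Finset.range k)
        (a := fun i => a i - b i / lam i)
        (b := fun i => 1 - 2 / (lam 0 + lam (k - 1)) * lam i) hρ0 fun i hi =>
          EllipticGD.abs_one_sub_two_div_mul_le hpos (hφ.monotone (Nat.zero_le i))
            (hφ.monotone (Nat.le_sub_one_of_lt (Finset.mem_range.1 hi))))
      congr 1
      refine Finset.sum_congr rfl fun i _ => ?_
      congr 1
      have hb : b i = b i / lam i * lam i := (div_mul_cancel₀ _ (hlam i).ne').symm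
      linear_combination (2 / (lam 0 + lam (k - 1))) * hb
    refine fun t => ⟨contract t, ?_⟩
    induction t with
    | zero => simp
    | succ t ih =>
      rw [pow_succ', mul_assoc]
      exact (contract t).trans (mul_le_mul_of_nonneg_left ih hρ0)
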